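/- \textbf{Theorem (Combinatorial Reduction to Normal Crossings).} \emph{Definitions.} A \emph{support fabric} is a pair $\mathcal F=(I,\mathcal H)$ where $I$ is a finite set and $\mathcal H$ is a set of subsets of $I$ (the \emph{strata}) such that every subset of a stratum is a stratum. For a finite set $J$ and $A\subset\mathbb R^J_{\ge 0}$ let $[[A]]$ be the convex hull of $A+\mathbb R^J_{\ge 0}$. A \emph{Newton polyhedra system} $\mathcal N=(\mathcal F;\{N_J\}_{J\in\mathcal H})$ over $\mathcal F$ consists, for each $J\in\mathcal H$, of a non-empty polyhedron $N_J\subset\mathbb R^J_{\ge 0}$ of the form $N_J=[[A]]$ with $A\subset\mathbb Z^J_{\ge 0}$, such that for all strata $J_1\subset J_2$ the polyhedron $N_{J_1}$ is the image of $N_{J_2}$ under the restriction map $\mathbb R^{J_2}\to\mathbb R^{J_1}$. Let $J\in\mathcal H$ be a non-empty stratum. The \emph{blow-up} $\pi_J(\mathcal F)=(I',\mathcal H')$ of $\mathcal F$ centered in $J$ has $I'=I\cup\{\infty\}$, $\infty\notin I$, and its strata are the $K\in\mathcal H$ with $J\not\subset K$ together with the sets $(K\setminus J)\cup A\cup\{\infty\}$,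 where $K\in\mathcal H$, $K\supset J$ and $A\subsetneq J$. The \emph{total transform} of $\mathcal N$ centered in $J$ is the Newton polyhedra system over $\pi_J(\mathcal F)$ whose polyhedron at $J'\in\mathcal H'$ is $N_{J'}$ if $\infty\notin J'$, and is $[[\lambda_{J'}(N_K)]]$ if $J'=(K\setminus J)\cup A\cup\{\infty\}$ as above, where $\lambda_{J'}:\mathbb R^K\to\mathbb R^{J'}$ is given by $\lambda_{J'}(\sigma)(j)=\sigma(j)$ for $j\ne\infty$ and $\lambda_{J'}(\sigma)(\infty)=\sum_{j\in J}\sigma(j)$. A Newton polyhedra system has \emph{normal crossings} if each of its polyhedra has a single vertex. \emph{Statement.} For every Newton polyhedra system $\mathcal N$ there is a finite sequence of total transforms (possibly of length $k=0$), each centered in some non-empty stratum of the preceding system, $$\mathcal N=\mathcal N_0\to\mathcal N_1\to\cdots\to\mathcal N_k,$$ such that $\mathcal N_k$ has normal crossings. -/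

import Mathlib

open scoped Pointwise

/-- A support fabric `(I, H)`: a finite index set `I` and a set `H` of subsets of `I` (the strata)
which is open for the Zariski topology, i.e. `J ∈ H` implies that every subset of `J` is in `H`. -/
structure SupportFabric where
  Idx : Type*
  [fintypeIdx : Fintype Idx]
  [decEqIdx : DecidableEq Idx]
  strata : Set (Finset Idx)
  isOpen_strata : ∀ J ∈ strata, ∀ J₁ : Finset Idx, J₁ ⊆ J → J₁ ∈ strata

attribute [instance] SupportFabric.fintypeIdx SupportFabric.decEqIdx

namespace SupportFabric

/-- The strata of the blow-up centered in `J`, as sets of indices in `I ∪ {∞}` (here `Option I`, with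
`∞ = none`). The strata outside the exceptional divisor are the `K ∈ H` with `J ⊄ K`; the
exceptional ones are the `(K \ J) ∪ A ∪ {∞}` with `J ⊆ K ∈ H` and `A ⊊ J`. -/
def blowUpStrata (F : SupportFabric) (J : Finset F.Idx) : Set (Finset (Option F.Idx)) :=
  {J' | ∃ K ∈ F.strata, ¬ J ⊆ K ∧ J' = K.map Function.Embedding.some} ∪
  {J' | ∃ K ∈ F.strata, J ⊆ K ∧ ∃ A : Finset F.Idx, A ⊂ J ∧ J' = Finset.insertNone ((K \ J) ∪ A)}

/-- The map `π_J^#` from the strata of the blow-up to the strata of the fabric: the identity on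
strata `J'` not containing `∞`, and `(K \ J) ∪ A ∪ {∞} ↦ K` on the exceptional ones; in the latter
case `K = (J' \ {∞}) ∪ J`. -/
def blowUpProj {I : Type*} [DecidableEq I] (J : Finset I) (J' : Finset (Option I)) : Finset I :=
  if none ∈ J' then J'.eraseNone ∪ J else J'.eraseNone

theorem blowUpProj_map {I : Type*} [DecidableEq I] (J K : Finset I) :
    blowUpProj J (K.map Function.Embedding.some) = K := by
  ext x
  simp [blowUpProj]

theorem blowUpProj_insertNone {I : Type*} [DecidableEq I] {J K A : Finset I}
    (hJ : J ⊆ K) (hA : A ⊂ J) :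
    blowUpProj J (Finset.insertNone ((K \ J) ∪ A)) = K := by
  ext x
  have h1 := @hJ x
  have h2 : x ∈ A → x ∈ J := fun hx => hA.1 hx
  simp only [blowUpProj, Finset.none_mem_insertNone, if_true, Finset.eraseNone_insertNone,
    Finset.mem_union, Finset.mem_sdiff]
  tauto

theorem eraseNone_subset_blowUpProj {I : Type*} [DecidableEq I] (J : Finset I)
    (J' : Finset (Option I)) : J'.eraseNone ⊆ blowUpProj J J' := by
  unfold blowUpProj
  split_ifs
  · exact Finset.subset_union_left
  · exact subset_rfl

theorem subset_blowUpProj {I : Type*} [DecidableEq I] {J : Finset I}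
    {J' : Finset (Option I)} (h : none ∈ J') : J ⊆ blowUpProj J J' := by
  rw [blowUpProj, if_pos h]
  exact Finset.subset_union_right

theorem blowUpProj_mono {I : Type*} [DecidableEq I] (J : Finset I)
    {J₁ J₂ : Finset (Option I)} (h : J₁ ⊆ J₂) : blowUpProj J J₁ ⊆ blowUpProj J J₂ := by
  have he : J₁.eraseNone ⊆ J₂.eraseNone := fun x hx => by
    simp only [Finset.mem_eraseNone] at hx ⊢
    exact h hx
  by_cases h1 : none ∈ J₁
  · rw [blowUpProj, if_pos h1, blowUpProj, if_pos (h h1)]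
    exact Finset.union_subset_union he subset_rfl
  · rw [blowUpProj, if_neg h1]
    exact he.trans (eraseNone_subset_blowUpProj J J₂)

theorem mem_blowUpStrata (F : SupportFabric) (J : Finset F.Idx) (J' : Finset (Option F.Idx)) :
    J' ∈ F.blowUpStrata J ↔ ¬ J ⊆ J'.eraseNone ∧ blowUpProj J J' ∈ F.strata := by
  constructor
  · rintro (⟨K, hK, hJK, rfl⟩ | ⟨K, hK, hJK, A, hA, rfl⟩)
    · rw [blowUpProj_map]
      exact ⟨by simpa using hJK, hK⟩
    · rw [blowUpProj_insertNone hJK hA]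
      refine ⟨fun h => hA.2 fun x hx => ?_, hK⟩
      have := h hx
      simp only [Finset.eraseNone_insertNone, Finset.mem_union, Finset.mem_sdiff] at this
      tauto
  · rintro ⟨h1, h2⟩
    by_cases hn : none ∈ J'
    · rw [blowUpProj, if_pos hn] at h2
      refine Or.inr ⟨_, h2, Finset.subset_union_right, J'.eraseNone ∩ J,
        ⟨Finset.inter_subset_right, fun h => h1 fun x hx => (Finset.mem_inter.1 (h hx)).1⟩, ?_⟩
      ext x
      cases x with
      | none => simpa using hn
      | some x =>
        simp only [Finset.some_mem_insertNone, Finset.mem_union, Finset.mem_sdiff,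
          Finset.mem_inter, Finset.mem_eraseNone]
        tauto
    · rw [blowUpProj, if_neg hn] at h2
      refine Or.inl ⟨_, h2, h1, ?_⟩
      ext x
      cases x with
      | none => simpa using hn
      | some x => simp

theorem blowUpProj_mem (F : SupportFabric) (J : Finset F.Idx) {J' : Finset (Option F.Idx)}
    (h : J' ∈ F.blowUpStrata J) : blowUpProj J J' ∈ F.strata :=
  ((F.mem_blowUpStrata J J').1 h).2

/-- The blow-up of a support fabric centered in `J`. -/
abbrev blowUp (F : SupportFabric) (J : Finset F.Idx) : SupportFabric where
  Idx := Option F.Idx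
  strata := F.blowUpStrata J
  isOpen_strata := by
    intro J₂ h2 J₁ h12
    rw [mem_blowUpStrata] at h2 ⊢
    refine ⟨fun h => h2.1 (h.trans fun x hx => ?_),
      F.isOpen_strata _ h2.2 _ (blowUpProj_mono J h12)⟩
    simp only [Finset.mem_eraseNone] at hx ⊢
    exact h12 hx

end SupportFabric

/-- The positive convex hull `[[A]]`, the convex hull of `A + ℝ_{≥0}^J`. -/
def positiveHull {ι : Type*} (A : Set (ι → ℝ)) : Set (ι → ℝ) :=
  convexHull ℝ (A + Set.Ici (0 : ι → ℝ))

theorem subset_positiveHull {ι : Type*} (A : Set (ι → ℝ)) : A ⊆ positiveHull A := fun a ha =>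
  subset_convexHull ℝ _ ⟨a, ha, 0, Set.mem_Ici.2 le_rfl, add_zero a⟩

theorem positiveHull_mono {ι : Type*} {A B : Set (ι → ℝ)} (h : A ⊆ B) :
    positiveHull A ⊆ positiveHull B :=
  convexHull_mono (Set.add_subset_add_right h)

theorem positiveHull_positiveHull {ι : Type*} (A : Set (ι → ℝ)) :
    positiveHull (positiveHull A) = positiveHull A := by
  refine subset_antisymm ?_ (subset_positiveHull _)
  have h : Set.Ici (0 : ι → ℝ) + Set.Ici (0 : ι → ℝ) ⊆ Set.Ici (0 : ι → ℝ) := by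
    rintro _ ⟨x, hx, y, hy, rfl⟩
    exact Set.mem_Ici.2 (add_nonneg (Set.mem_Ici.1 hx) (Set.mem_Ici.1 hy))
  refine convexHull_min ?_ (convex_convexHull ℝ _)
  calc positiveHull A + Set.Ici (0 : ι → ℝ)
      ⊆ convexHull ℝ (A + Set.Ici (0 : ι → ℝ)) + convexHull ℝ (Set.Ici (0 : ι → ℝ)) :=
        Set.add_subset_add_left (subset_convexHull ℝ _)
    _ = convexHull ℝ (A + Set.Ici (0 : ι → ℝ) + Set.Ici (0 : ι → ℝ)) := (convexHull_add _ _).symm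
    _ ⊆ _ := convexHull_mono (by rw [add_assoc]; exact Set.add_subset_add_left h)

theorem image_positiveHull {ι κ : Type*} (f : (ι → ℝ) →ₗ[ℝ] (κ → ℝ)) (A : Set (ι → ℝ)) :
    f '' positiveHull A = convexHull ℝ (f '' A + f '' Set.Ici 0) := by
  rw [positiveHull, f.image_convexHull, Set.image_add]

theorem image_positiveHull_of_image_eq {ι κ : Type*} (f : (ι → ℝ) →ₗ[ℝ] (κ → ℝ))
    (hf : f '' Set.Ici 0 = Set.Ici 0) (A : Set (ι → ℝ)) :
    f '' positiveHull A = positiveHull (f '' A) := by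
  rw [image_positiveHull, hf, positiveHull]

theorem positiveHull_image_positiveHull {ι κ : Type*} (f : (ι → ℝ) →ₗ[ℝ] (κ → ℝ))
    (hf : ∀ x, 0 ≤ x → 0 ≤ f x) (A : Set (ι → ℝ)) :
    positiveHull (f '' positiveHull A) = positiveHull (f '' A) := by
  refine subset_antisymm ?_ (positiveHull_mono (Set.image_mono (subset_positiveHull A)))
  rw [← positiveHull_positiveHull (f '' A)]
  refine positiveHull_mono ?_
  rw [image_positiveHull]
  refine convexHull_mono (Set.add_subset_add_left ?_)
  rintro _ ⟨x, hx, rfl⟩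
  exact hf x hx

/-- `Δ` is a characteristic polyhedron with denominator `d`: it is `[[A]]` for some
`A ⊆ (1/d) ℤ_{≥0}^J`. -/
def IsCharPolyhedron {ι : Type*} (d : ℕ) (Δ : Set (ι → ℝ)) : Prop :=
  ∃ A : Set (ι → ℝ), (∀ a ∈ A, ∀ j, ∃ n : ℕ, a j = (n : ℝ) / d) ∧ Δ = positiveHull A

/-- A polyhedra system with denominator `d` over a support fabric: for each stratum `J` a
characteristic polyhedron `Δ_J ⊆ ℝ_{≥0}^J` with denominator `d`, such that `Δ_{J₁}` is the
projection of `Δ_{J₂}` for all strata `J₁ ⊆ J₂`. -/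
structure PolyhedraSystem (d : ℕ) where
  fabric : SupportFabric
  denom_pos : 0 < d
  poly : (J : fabric.strata) → Set (J.1 → ℝ)
  isCharPolyhedron : ∀ J, IsCharPolyhedron d (poly J)
  compat : ∀ (J₁ J₂ : fabric.strata) (h : J₁.1 ⊆ J₂.1),
    poly J₁ = Finset.restrict₂ (π := fun _ => ℝ) h '' poly J₂

/-- A Newton polyhedra system is a polyhedra system with denominator `1`. -/
abbrev NewtonPolyhedraSystem := PolyhedraSystem 1

/-- The linear map `λ_{J'} : ℝ^K → ℝ^{J'}`, `K = π_J^#(J')`, which keeps the coordinates `j ≠ ∞` and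
has `∞`-coordinate `∑_{j ∈ J} σ(j)`. If `∞ ∉ J'`, it is the identification `ℝ^{J'} = ℝ^{J'}`. -/
def blowUpMap {I : Type*} [DecidableEq I] (J : Finset I) (J' : Finset (Option I)) :
    (SupportFabric.blowUpProj J J' → ℝ) →ₗ[ℝ] (J' → ℝ) where
  toFun σ
    | ⟨some i, h⟩ =>
        σ ⟨i, SupportFabric.eraseNone_subset_blowUpProj J J' (Finset.mem_eraseNone.2 h)⟩
    | ⟨none, h⟩ => ∑ j : J, σ ⟨j, SupportFabric.subset_blowUpProj h j.2⟩
  map_add' σ τ := by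
    funext x
    rcases x with ⟨_ | i, h⟩
    · simp [Finset.sum_add_distrib]
    · simp
  map_smul' c σ := by
    funext x
    rcases x with ⟨_ | i, h⟩
    · simp [Finset.mul_sum]
    · simp

theorem blowUpMap_nonneg {I : Type*} [DecidableEq I] (J : Finset I) (J' : Finset (Option I))
    (σ : SupportFabric.blowUpProj J J' → ℝ) (h : 0 ≤ σ) : 0 ≤ blowUpMap J J' σ := by
  rintro ⟨_ | i, hi⟩
  · exact Finset.sum_nonneg fun j _ => h _
  · exact h _

theorem blowUpMap_image_Ici {I : Type*} [DecidableEq I] (J : Finset I) {J' : Finset (Option I)}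
    (h : none ∉ J') : blowUpMap J J' '' Set.Ici 0 = Set.Ici 0 := by
  refine subset_antisymm ?_ fun y hy => ?_
  · rintro _ ⟨x, hx, rfl⟩
    exact blowUpMap_nonneg J J' x hx
  · have hm : ∀ i : SupportFabric.blowUpProj J J', some i.1 ∈ J' := fun i => by
      have he : SupportFabric.blowUpProj J J' = J'.eraseNone := if_neg h
      exact Finset.mem_eraseNone.1 (he ▸ i.2)
    refine ⟨fun i => y ⟨some i.1, hm i⟩, Set.mem_Ici.2 fun i => hy _, ?_⟩
    funext x
    rcases x with ⟨_ | i, hi⟩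
    · exact absurd hi h
    · rfl

theorem restrict_comp_blowUpMap {I : Type*} [DecidableEq I] (J : Finset I)
    {J₁ J₂ : Finset (Option I)} (h : J₁ ⊆ J₂) (σ : SupportFabric.blowUpProj J J₂ → ℝ) :
    Finset.restrict₂ (π := fun _ => ℝ) h (blowUpMap J J₂ σ) =
      blowUpMap J J₁
        (Finset.restrict₂ (π := fun _ => ℝ) (SupportFabric.blowUpProj_mono J h) σ) := by
  funext x
  rcases x with ⟨_ | i, hi⟩ <;> rfl

theorem restrict_image_positiveHull {I : Type*} {J₁ J₂ : Finset I} (h : J₁ ⊆ J₂)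
    (A : Set (J₂ → ℝ)) :
    Finset.restrict₂ (π := fun _ => ℝ) h '' positiveHull A =
      positiveHull (Finset.restrict₂ (π := fun _ => ℝ) h '' A) := by
  classical
  refine image_positiveHull_of_image_eq
    (LinearMap.funLeft ℝ ℝ fun i : J₁ => (⟨i.1, h i.2⟩ : J₂)) ?_ A
  refine subset_antisymm ?_ fun y hy => ?_
  · rintro _ ⟨x, hx, rfl⟩
    exact Set.mem_Ici.2 fun i => hx _
  · refine ⟨fun i => if hi : i.1 ∈ J₁ then y ⟨i.1, hi⟩ else 0, Set.mem_Ici.2 fun i => ?_, ?_⟩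
    · dsimp only
      split_ifs with hi
      · exact hy _
      · exact le_rfl
    · funext i
      simp [LinearMap.funLeft]

namespace PolyhedraSystem

/-- The polyhedra of the total transform: `Δ⁰_{J'} = [[λ_{J'}(Δ_K)]]`, `K = π_J^#(J')`, if `∞ ∈ J'`, and
`Δ⁰_{J'} = Δ_{J'}` (with indices in `I` regarded as indices in `I ∪ {∞}`) otherwise. -/
noncomputable def totalPoly {d : ℕ} (D : PolyhedraSystem d) (J : Finset D.fabric.Idx)
    (J' : D.fabric.blowUpStrata J) :
    Set (J'.1 → ℝ) :=
  let ΔK := D.poly ⟨SupportFabric.blowUpProj J J'.1, D.fabric.blowUpProj_mem J J'.2⟩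
  if none ∈ J'.1 then positiveHull (blowUpMap J J'.1 '' ΔK) else blowUpMap J J'.1 '' ΔK

theorem totalPoly_eq {d : ℕ} (D : PolyhedraSystem d) (J : Finset D.fabric.Idx)
    (J' : D.fabric.blowUpStrata J) :
    D.totalPoly J J' = positiveHull (blowUpMap J J'.1 ''
      D.poly ⟨SupportFabric.blowUpProj J J'.1, D.fabric.blowUpProj_mem J J'.2⟩) := by
  unfold totalPoly
  split_ifs with h
  · rfl
  · obtain ⟨A, -, hA⟩ := D.isCharPolyhedron
      ⟨SupportFabric.blowUpProj J J'.1, D.fabric.blowUpProj_mem J J'.2⟩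
    rw [hA, image_positiveHull_of_image_eq _ (blowUpMap_image_Ici J h), positiveHull_positiveHull]

theorem isCharPolyhedron_totalPoly {d : ℕ} (D : PolyhedraSystem d) (J : Finset D.fabric.Idx)
    (J' : D.fabric.blowUpStrata J) : IsCharPolyhedron d (D.totalPoly J J') := by
  obtain ⟨A, hd, hA⟩ := D.isCharPolyhedron
    ⟨SupportFabric.blowUpProj J J'.1, D.fabric.blowUpProj_mem J J'.2⟩
  refine ⟨blowUpMap J J'.1 '' A, ?_, ?_⟩
  · rintro _ ⟨a, ha, rfl⟩ ⟨_ | i, hi⟩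
    · choose n hn using hd a ha
      refine ⟨∑ j : J, n ⟨j, SupportFabric.subset_blowUpProj hi j.2⟩, ?_⟩
      rw [Nat.cast_sum, Finset.sum_div]
      exact Finset.sum_congr rfl fun j _ => hn _
    · exact hd a ha _
  · rw [totalPoly_eq, hA]
    exact positiveHull_image_positiveHull _ (blowUpMap_nonneg J J'.1) A

theorem compat_totalPoly {d : ℕ} (D : PolyhedraSystem d) (J : Finset D.fabric.Idx)
    (J₁ J₂ : D.fabric.blowUpStrata J) (h : J₁.1 ⊆ J₂.1) :
    D.totalPoly J J₁ = Finset.restrict₂ (π := fun _ => ℝ) h '' D.totalPoly J J₂ := by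
  rw [totalPoly_eq, totalPoly_eq, restrict_image_positiveHull,
    D.compat ⟨_, D.fabric.blowUpProj_mem J J₁.2⟩ ⟨_, D.fabric.blowUpProj_mem J J₂.2⟩
      (SupportFabric.blowUpProj_mono J h), Set.image_image, Set.image_image]
  congr 1
  exact Set.image_congr fun σ _ => (restrict_comp_blowUpMap J h σ).symm

/-- The total transform of a polyhedra system centered in `J`. -/
noncomputable def totalTransform {d : ℕ} (D : PolyhedraSystem d) (J : Finset D.fabric.Idx) :
    PolyhedraSystem d where
  fabric := D.fabric.blowUp J
  denom_pos := D.denom_pos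
  poly := D.totalPoly J
  isCharPolyhedron := D.isCharPolyhedron_totalPoly J
  compat := D.compat_totalPoly J

/-- `D'` is the total transform of `D` centered in some non-empty stratum. -/
def IsTotalTransform {d : ℕ} (D D' : PolyhedraSystem d) : Prop :=
  ∃ J ∈ D.fabric.strata, J.Nonempty ∧ D' = D.totalTransform J

/-- Normal crossings: each polyhedron has a single vertex (extreme point). -/
def HasNormalCrossings (N : NewtonPolyhedraSystem) : Prop :=
  ∀ J : N.fabric.strata, ∃ v, Set.extremePoints ℝ (N.poly J) = {v}

end PolyhedraSystem

/-! This is principalization of a monomial ideal. All polyhedra of a Newton system are generated by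
the restrictions of one finite family of exponent vectors on the whole index set
(`generatedBy_minimal_globalExponents`), and a total transform acts on these vectors as the pullback
of monomials. If any two of them are comparable on every stratum, each polyhedron is an orthant,
with a single vertex.

Comparability survives blow-ups, so pairs can be treated one at a time. A pair `x`, `y` is
incomparable on a stratum only if some edge `{i, j}` has `x i < y i` and `y j < x j`. Blowing up
such an edge of maximal spread `(y i - x i) + (x j - y j)` destroys it, and every bad edge through
`∞` has smaller spread because the two differences partly cancel at `∞` (`badEdges_blowUp`). Hence
the pair (maximal spread, number of bad edges attaining it) decreases lexicographically. -/

theorem mem_positiveHull_of_le {ι : Type*} {A : Set (ι → ℝ)} {x y : ι → ℝ}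
    (hx : x ∈ positiveHull A) (h : x ≤ y) : y ∈ positiveHull A := by
  rw [← positiveHull_positiveHull]
  exact subset_convexHull ℝ _ ⟨x, hx, y - x, Set.mem_Ici.2 (sub_nonneg.2 h), add_sub_cancel _ _⟩

theorem positiveHull_eq_Ici {ι : Type*} {A : Set (ι → ℝ)} {v : ι → ℝ} (h : IsLeast A v) :
    positiveHull A = Set.Ici v := by
  refine subset_antisymm (convexHull_min ?_ (convex_Ici v)) fun x hx =>
    mem_positiveHull_of_le (subset_positiveHull A h.1) hx
  rintro _ ⟨a, ha, b, hb, rfl⟩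
  exact (h.2 ha).trans (le_add_of_nonneg_right hb)

theorem extremePoints_Ici_pi {ι : Type*} (v : ι → ℝ) :
    Set.extremePoints ℝ (Set.Ici v) = {v} := by
  ext w
  rw [mem_extremePoints, Set.mem_singleton_iff]
  constructor
  · rintro ⟨hw, h⟩
    -- `w` is the midpoint of `v` and its reflection `w + (w - v)`.
    have h2 : w + (w - v) ∈ Set.Ici v :=
      Set.mem_Ici.2 (le_add_of_le_of_nonneg hw (sub_nonneg.2 hw))
    refine ((h v Set.self_mem_Ici _ h2 ⟨1 / 2, 1 / 2, by norm_num, by norm_num, by norm_num, ?_⟩).1).symm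
    funext i
    simp only [Pi.add_apply, Pi.smul_apply, Pi.sub_apply, smul_eq_mul]
    ring
  · rintro rfl
    have key : ∀ x ∈ Set.Ici w, ∀ y ∈ Set.Ici w, w ∈ openSegment ℝ x y → x = w := by
      rintro x hx y hy ⟨a, b, ha, hb, hab, he⟩
      funext i
      have hi := congrFun he i
      simp only [Pi.add_apply, Pi.smul_apply, smul_eq_mul] at hi
      have h1 : w i ≤ x i := hx i
      have h2 : w i ≤ y i := hy i
      refine le_antisymm ?_ h1
      by_contra! hlt
      have h3 := mul_lt_mul_of_pos_left hlt ha
      have h4 := mul_le_mul_of_nonneg_left h2 hb.le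
      have h5 : a * w i + b * w i = w i := by rw [← add_mul, hab, one_mul]
      linarith
    refine ⟨Set.self_mem_Ici, fun x hx y hy hxy => ⟨key x hx y hy hxy, key y hy x hx ?_⟩⟩
    rwa [openSegment_symm]

/-- The restriction to `J` of a natural number valued function, as a real vector. -/
def natRestrict {I : Type*} (J : Finset I) (x : I → ℕ) : J → ℝ := fun j => x j

/-- The exponent vector on `I ∪ {∞}` obtained from an exponent vector on `I` by blowing up `J`. -/
def blowUpExponent {I : Type*} (J : Finset I) (x : I → ℕ) : Option I → ℕ
  | some i => x i
  | none => ∑ j ∈ J, x j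

theorem blowUpMap_natRestrict {I : Type*} [DecidableEq I] (J : Finset I) (J' : Finset (Option I))
    (x : I → ℕ) :
    blowUpMap J J' (natRestrict _ x) = natRestrict J' (blowUpExponent J x) := by
  funext k
  rcases k with ⟨_ | i, h⟩
  · change ∑ j : J, (x j : ℝ) = ((∑ j ∈ J, x j : ℕ) : ℝ)
    rw [Nat.cast_sum, Finset.sum_coe_sort J fun j => (x j : ℝ)]
  · rfl

/-! ### Comparability of two exponent vectors under blow-up -/

namespace SupportFabric

/-- On each stratum, one of the two exponent vectors divides the other. -/
def ComparableOnStrata (F : SupportFabric) (x y : F.Idx → ℕ) : Prop :=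
  ∀ J ∈ F.strata, (∀ j ∈ J, x j ≤ y j) ∨ ∀ j ∈ J, y j ≤ x j

theorem blowUpExponent_le {I : Type*} [DecidableEq I] {J : Finset I} {J' : Finset (Option I)}
    {x y : I → ℕ} (h : ∀ j ∈ blowUpProj J J', x j ≤ y j) :
    ∀ j ∈ J', blowUpExponent J x j ≤ blowUpExponent J y j := by
  rintro (_ | i) hj
  · exact Finset.sum_le_sum fun j hjJ => h j (subset_blowUpProj hj hjJ)
  · exact h i (eraseNone_subset_blowUpProj J J' (Finset.mem_eraseNone.2 hj))

theorem ComparableOnStrata.blowUp {F : SupportFabric} {x y : F.Idx → ℕ}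
    (h : F.ComparableOnStrata x y) (J : Finset F.Idx) :
    (F.blowUp J).ComparableOnStrata (blowUpExponent J x) (blowUpExponent J y) := fun _ hJ' =>
  (h _ (F.blowUpProj_mem J hJ')).imp blowUpExponent_le blowUpExponent_le

/-- The edges along which neither of two exponent vectors divides the other. -/
def badEdges (F : SupportFabric) (x y : F.Idx → ℕ) : Set (F.Idx × F.Idx) :=
  {p | {p.1, p.2} ∈ F.strata ∧ x p.1 < y p.1 ∧ y p.2 < x p.2}

/-- The amount by which two exponent vectors fail to be comparable along an edge. -/
def spread {I : Type*} (x y : I → ℕ) (p : I × I) : ℕ := (y p.1 - x p.1) + (x p.2 - y p.2)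

/-- Incomparability is witnessed by two indices, and these span a stratum because strata are closed
under subsets. -/
theorem comparableOnStrata_of_badEdges_eq_empty {F : SupportFabric} {x y : F.Idx → ℕ}
    (h : F.badEdges x y = ∅) : F.ComparableOnStrata x y := by
  intro J hJ
  by_contra! hc
  obtain ⟨⟨j, hj, hj'⟩, i, hi, hi'⟩ := hc
  refine Set.eq_empty_iff_forall_notMem.1 h (i, j) ⟨F.isOpen_strata J hJ _ ?_, hi', hj'⟩
  simp [Finset.insert_subset_iff, hi, hj]

/-- For `e = (i, j)`, the difference `y - x` at `∞` is `(y i - x i) - (x j - y j)`. A bad edge `(∞,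
l)` is thus strictly narrower than the old bad edge `(i, l)`, and `(k, ∞)` than `(k, j)`. Edges
avoiding `∞` keep their spread. -/
theorem badEdges_blowUp {F : SupportFabric} {x y : F.Idx → ℕ} {M : ℕ}
    (hM : ∀ p ∈ F.badEdges x y, spread x y p ≤ M) {e : F.Idx × F.Idx} (he : e ∈ F.badEdges x y)
    {q : Option F.Idx × Option F.Idx}
    (hq : q ∈ (F.blowUp {e.1, e.2}).badEdges (blowUpExponent {e.1, e.2} x)
      (blowUpExponent {e.1, e.2} y)) :
    spread (blowUpExponent {e.1, e.2} x) (blowUpExponent {e.1, e.2} y) q < M ∨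
      ∃ p ∈ F.badEdges x y, p ≠ e ∧ q = (some p.1, some p.2) := by
  obtain ⟨i, j⟩ := e
  obtain ⟨-, hi, hj⟩ := he
  obtain ⟨q₁, q₂⟩ := q
  obtain ⟨hs, h1, h2⟩ := hq
  have hij : i ≠ j := by rintro rfl; exact lt_asymm hi hj
  have hs' := ((F.mem_blowUpStrata _ _).1 hs).2
  have hs'' := ((F.mem_blowUpStrata _ _).1 hs).1
  have hbad : ∀ a b, x a < y a → y b < x b → {a, b} ⊆ blowUpProj {i, j} {q₁, q₂} →
      (y a - x a) + (x b - y b) ≤ M := fun a b ha hb hab =>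
    hM (a, b) ⟨F.isOpen_strata _ hs' _ hab, ha, hb⟩
  rcases q₁ with _ | k <;> rcases q₂ with _ | l <;>
    simp only [blowUpExponent, Finset.sum_pair hij] at h1 h2 hi hj ⊢
  · exact absurd h1 h2.asymm
  · left
    have := hbad i l hi h2 (by
      simp [blowUpProj, Finset.insert_subset_iff])
    simp only [spread, blowUpExponent, Finset.sum_pair hij]
    omega
  · left
    have := hbad k j h1 hj (by
      simp [blowUpProj, Finset.insert_subset_iff])
    simp only [spread, blowUpExponent, Finset.sum_pair hij]
    omega
  · right
    refine ⟨(k, l), ⟨F.isOpen_strata _ hs' _ ?_, h1, h2⟩, ?_, rfl⟩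
    · simp [blowUpProj, Finset.insert_subset_iff]
    · rintro h
      obtain ⟨rfl, rfl⟩ := Prod.mk.inj h
      -- The center itself is no longer a stratum.
      exact hs'' (by simp [Finset.insert_subset_iff])

end SupportFabric

/-! ### Sequences of total transforms and termination -/

namespace PolyhedraSystem

open SupportFabric

/-- A finite family of exponent vectors generates all the polyhedra of a system. -/
def GeneratedBy {ι : Type*} {d : ℕ} (N : PolyhedraSystem d) (m : ι → N.fabric.Idx → ℕ) : Prop :=
  ∀ J, N.poly J = positiveHull (Set.range fun i => natRestrict J.1 (m i))

theorem GeneratedBy.totalTransform {ι : Type*} {d : ℕ} {N : PolyhedraSystem d}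
    {m : ι → N.fabric.Idx → ℕ} (h : N.GeneratedBy m) (J : Finset N.fabric.Idx) :
    (N.totalTransform J).GeneratedBy fun i => blowUpExponent J (m i) := by
  intro J'
  refine (N.totalPoly_eq J J').trans ?_
  rw [h, positiveHull_image_positiveHull _ (blowUpMap_nonneg J J'.1), ← Set.range_comp]
  congr 2
  funext i
  exact blowUpMap_natRestrict J J'.1 (m i)

/-- Some sequence of total transforms, with non-empty centers, leads from `(N, m)` to `(N', m')`. -/
inductive Reaches {ι : Type*} {d : ℕ} (N : PolyhedraSystem d) (m : ι → N.fabric.Idx → ℕ) :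
    (N' : PolyhedraSystem d) → (ι → N'.fabric.Idx → ℕ) → Prop
  | refl : Reaches N m N m
  | tail {N' : PolyhedraSystem d} {m' : ι → N'.fabric.Idx → ℕ} (J : Finset N'.fabric.Idx)
      (h : Reaches N m N' m') (hJ : J ∈ N'.fabric.strata) (hne : J.Nonempty) :
      Reaches N m (N'.totalTransform J) fun i => blowUpExponent J (m' i)

namespace Reaches

variable {ι : Type*} {d : ℕ} {N N' N'' : PolyhedraSystem d} {m : ι → N.fabric.Idx → ℕ}
  {m' : ι → N'.fabric.Idx → ℕ} {m'' : ι → N''.fabric.Idx → ℕ}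

theorem trans (h : Reaches N m N' m') (h' : Reaches N' m' N'' m'') : Reaches N m N'' m'' := by
  induction h' with
  | refl => exact h
  | tail J _ hJ hne ih => exact ih.tail J hJ hne

theorem reflTransGen (h : Reaches N m N' m') : Relation.ReflTransGen IsTotalTransform N N' := by
  induction h with
  | refl => exact .refl
  | tail J _ hJ hne ih => exact ih.tail ⟨J, hJ, hne, rfl⟩

theorem generatedBy (h : Reaches N m N' m') (hm : N.GeneratedBy m) : N'.GeneratedBy m' := by
  induction h with
  | refl => exact hm
  | tail J _ _ _ ih => exact ih.totalTransform J

theorem comparableOnStrata (h : Reaches N m N' m') {a b : ι}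
    (hab : N.fabric.ComparableOnStrata (m a) (m b)) :
    N'.fabric.ComparableOnStrata (m' a) (m' b) := by
  induction h with
  | refl => exact hab
  | tail J _ _ _ ih => exact ih.blowUp J

end Reaches

theorem exists_reaches_comparableOnStrata_of_spread_lt {ι : Type*} {d : ℕ} (a b : ι) (M : ℕ) :
    ∀ (N : PolyhedraSystem d) (m : ι → N.fabric.Idx → ℕ),
      (∀ p ∈ N.fabric.badEdges (m a) (m b), spread (m a) (m b) p < M) →
      ∃ N' m', Reaches N m N' m' ∧ N'.fabric.ComparableOnStrata (m' a) (m' b) := by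
  induction M with
  | zero =>
    intro N m h
    exact ⟨N, m, .refl, comparableOnStrata_of_badEdges_eq_empty
      (Set.eq_empty_iff_forall_notMem.2 fun p hp => Nat.not_lt_zero _ (h p hp))⟩
  | succ M ihM =>
    intro N m h
    -- Inner induction on the number of bad edges of the largest allowed spread `M`; once none is
    -- left, the bound drops to `M`.
    induction hn : {p ∈ N.fabric.badEdges (m a) (m b) | spread (m a) (m b) p = M}.ncard using
      Nat.strong_induction_on generalizing N m with
    | _ n ih =>
    by_cases hex : ∃ e ∈ N.fabric.badEdges (m a) (m b), spread (m a) (m b) e = M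
    · obtain ⟨e, he, heM⟩ := hex
      have key := fun q hq => badEdges_blowUp (q := q) (fun p hp => Nat.lt_succ_iff.1 (h p hp)) he hq
      have hcard : {q ∈ (N.fabric.blowUp {e.1, e.2}).badEdges (blowUpExponent {e.1, e.2} (m a))
          (blowUpExponent {e.1, e.2} (m b)) | spread (blowUpExponent {e.1, e.2} (m a))
          (blowUpExponent {e.1, e.2} (m b)) q = M}.ncard < n := by
        rw [← hn]
        calc _ ≤ (Prod.map some some '' ({p ∈ N.fabric.badEdges (m a) (m b) |
                  spread (m a) (m b) p = M} \ {e})).ncard := by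
              refine Set.ncard_le_ncard ?_ (Set.toFinite _)
              rintro q ⟨hq, hqM⟩
              rcases key q hq with hlt | ⟨p, hp, hpe, rfl⟩
              · exact absurd hqM hlt.ne
              · exact ⟨p, ⟨⟨hp, hqM⟩, hpe⟩, rfl⟩
          _ ≤ _ := Set.ncard_image_le (Set.toFinite _)
          _ < _ := Set.ncard_sdiff_singleton_lt_of_mem ⟨he, heM⟩ (Set.toFinite _)
      obtain ⟨N', m', hr, hc⟩ := ih _ hcard (N.totalTransform {e.1, e.2})
        (fun i => blowUpExponent {e.1, e.2} (m i)) (fun q hq => by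
          rcases key q hq with hlt | ⟨p, hp, -, rfl⟩
          · exact hlt.trans (Nat.lt_succ_self M)
          · exact h p hp) rfl
      exact ⟨N', m', (Reaches.refl.tail _ he.1 (Finset.insert_nonempty _ _)).trans hr, hc⟩
    · exact ihM N m fun p hp => lt_of_le_of_ne (Nat.lt_succ_iff.1 (h p hp)) fun hM => hex ⟨p, hp, hM⟩

theorem exists_reaches_comparableOnStrata {ι : Type*} {d : ℕ} (N : PolyhedraSystem d)
    (m : ι → N.fabric.Idx → ℕ) (s : Finset (ι × ι)) :
    ∃ N' m', Reaches N m N' m' ∧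
      ∀ p ∈ s, N'.fabric.ComparableOnStrata (m' p.1) (m' p.2) := by
  classical
  induction s using Finset.induction_on with
  | empty => exact ⟨N, m, .refl, by simp⟩
  | insert p s _ ih =>
    obtain ⟨N₁, m₁, h₁, hs⟩ := ih
    obtain ⟨M, hM⟩ := (Set.finite_range (spread (m₁ p.1) (m₁ p.2))).bddAbove
    obtain ⟨N₂, m₂, h₂, hp⟩ := exists_reaches_comparableOnStrata_of_spread_lt p.1 p.2 (M + 1) N₁ m₁
      fun q _ => Nat.lt_succ_iff.2 (hM ⟨q, rfl⟩)
    refine ⟨N₂, m₂, h₁.trans h₂, fun q hq => ?_⟩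
    rcases Finset.mem_insert.1 hq with rfl | hq
    · exact hp
    · exact h₂.comparableOnStrata (hs q hq)

/-! ### Finite generation by global exponent vectors -/

theorem mem_poly_of_le {d : ℕ} (N : PolyhedraSystem d) {J : N.fabric.strata} {x y : J.1 → ℝ}
    (hx : x ∈ N.poly J) (h : x ≤ y) : y ∈ N.poly J := by
  obtain ⟨A, -, hA⟩ := N.isCharPolyhedron J
  rw [hA] at hx ⊢
  exact mem_positiveHull_of_le hx h

theorem positiveHull_poly {d : ℕ} (N : PolyhedraSystem d) (J : N.fabric.strata) :
    positiveHull (N.poly J) = N.poly J := by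
  obtain ⟨A, -, hA⟩ := N.isCharPolyhedron J
  rw [hA, positiveHull_positiveHull]

/-- An integral point of one polyhedron extends to an exponent vector on the whole index set which
belongs to all the polyhedra. -/
theorem exists_extension {d : ℕ} (N : PolyhedraSystem d) (J : N.fabric.strata) (b : J.1 → ℕ)
    (hb : (fun j => (b j : ℝ)) ∈ N.poly J) :
    ∃ x : N.fabric.Idx → ℕ, (natRestrict J.1 x = fun j => (b j : ℝ)) ∧
      ∀ K, natRestrict K.1 x ∈ N.poly K := by
  -- Project `b` to `J ∩ K` and lift the result to the polyhedron of `K`.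
  have hK : ∀ K : N.fabric.strata, ∃ c ∈ N.poly K, ∀ (i : N.fabric.Idx) (hiJ : i ∈ J.1)
      (hiK : i ∈ K.1), c ⟨i, hiK⟩ = b ⟨i, hiJ⟩ := by
    intro K
    have hL : J.1 ∩ K.1 ∈ N.fabric.strata :=
      N.fabric.isOpen_strata _ J.2 _ Finset.inter_subset_left
    have h1 : Finset.restrict₂ (π := fun _ => ℝ) (Finset.inter_subset_left (s₁ := J.1) (s₂ := K.1))
        (fun j => (b j : ℝ)) ∈ N.poly ⟨_, hL⟩ := by
      rw [N.compat ⟨_, hL⟩ J Finset.inter_subset_left]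
      exact ⟨_, hb, rfl⟩
    rw [N.compat ⟨_, hL⟩ K Finset.inter_subset_right] at h1
    obtain ⟨c, hc, hcb⟩ := h1
    exact ⟨c, hc, fun i hiJ hiK => congrFun hcb ⟨i, Finset.mem_inter.2 ⟨hiJ, hiK⟩⟩⟩
  choose c hc hcb using hK
  -- Filling the coordinates outside `J` with a bound `C` for all the lifts dominates each of them,
  -- and the polyhedra are upward closed.
  obtain ⟨C, hC⟩ := (Set.finite_range fun p : Σ K : N.fabric.strata, K.1 => ⌈c p.1 p.2⌉₊).bddAbove
  refine ⟨fun i => if hi : i ∈ J.1 then b ⟨i, hi⟩ else C, ?_, fun K => ?_⟩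
  · funext j
    simp [natRestrict]
  · refine N.mem_poly_of_le (hc K) fun k => ?_
    by_cases hk : k.1 ∈ J.1
    · simp [natRestrict, hk, hcb K k.1 hk k.2]
    · simp only [natRestrict, hk, dif_neg, not_false_eq_true]
      exact (Nat.le_ceil _).trans (Nat.cast_le.2 (hC ⟨⟨K, k⟩, rfl⟩))

/-- The exponent vectors which belong to all the polyhedra of a system. -/
def globalExponents {d : ℕ} (N : PolyhedraSystem d) : Set (N.fabric.Idx → ℕ) :=
  {x | ∀ K, natRestrict K.1 x ∈ N.poly K}

/-- Dickson's lemma: an antichain in `ℕ^I` with `I` finite is finite. -/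
theorem finite_minimal_globalExponents {d : ℕ} (N : PolyhedraSystem d) :
    {x | Minimal (· ∈ N.globalExponents) x}.Finite :=
  (setOfPred_minimal_antichain _).finite_of_partiallyWellOrderedOn (Set.isPWO_of_wellQuasiOrderedLE _)

theorem generatedBy_minimal_globalExponents (N : NewtonPolyhedraSystem) :
    N.GeneratedBy (Subtype.val : {x | Minimal (· ∈ N.globalExponents) x} → N.fabric.Idx → ℕ) := by
  intro J
  refine subset_antisymm ?_ ?_
  · obtain ⟨A, hA, hJ⟩ := N.isCharPolyhedron J
    rw [← positiveHull_positiveHull (Set.range _), hJ]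
    refine positiveHull_mono fun a ha => ?_
    choose b hb using hA a ha
    obtain rfl : a = fun j => (b j : ℝ) := funext fun j => by rw [hb j, Nat.cast_one, div_one]
    obtain ⟨x, hxb, hx⟩ := N.exists_extension J b (hJ ▸ subset_positiveHull A ha)
    obtain ⟨y, hyx, hy⟩ := exists_minimal_le_of_wellFoundedLT (· ∈ N.globalExponents) x hx
    rw [← hxb]
    exact mem_positiveHull_of_le (subset_positiveHull _ ⟨⟨y, hy⟩, rfl⟩)
      fun j => Nat.cast_le.2 (hyx j)
  · rw [← N.positiveHull_poly J]
    refine positiveHull_mono ?_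
    rintro _ ⟨x, rfl⟩
    exact x.2.1 J

/-- On a given stratum, a vector of least coordinate sum is a least element: a comparable vector
below it has the same sum, hence the same coordinates there. -/
theorem hasNormalCrossings_of_comparableOnStrata {ι : Type*} [Finite ι] [Nonempty ι]
    {N : NewtonPolyhedraSystem} {m : ι → N.fabric.Idx → ℕ} (hm : N.GeneratedBy m)
    (h : ∀ a b, N.fabric.ComparableOnStrata (m a) (m b)) : N.HasNormalCrossings := by
  intro J
  obtain ⟨a, ha⟩ := Finite.exists_min fun i => ∑ j ∈ J.1, m i j
  refine ⟨natRestrict J.1 (m a), ?_⟩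
  suffices hl : IsLeast (Set.range fun i => natRestrict J.1 (m i)) (natRestrict J.1 (m a)) by
    rw [hm J, positiveHull_eq_Ici hl, extremePoints_Ici_pi]
  refine ⟨⟨a, rfl⟩, ?_⟩
  rintro _ ⟨b, rfl⟩ j
  refine Nat.cast_le.2 ?_
  rcases h a b J.1 J.2 with hab | hba
  · exact hab j j.2
  · exact ((Finset.sum_eq_sum_iff_of_le hba).1
      ((Finset.sum_le_sum hba).antisymm (ha b)) j j.2).ge

end PolyhedraSystem

theorem mainTheorem2 (N : NewtonPolyhedraSystem) (hN : ∀ J, (N.poly J).Nonempty) :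
    ∃ N' : NewtonPolyhedraSystem,
      Relation.ReflTransGen PolyhedraSystem.IsTotalTransform N N' ∧ N'.HasNormalCrossings := by
  have hm := N.generatedBy_minimal_globalExponents
  have : Finite {x | Minimal (· ∈ N.globalExponents) x} := N.finite_minimal_globalExponents
  rcases isEmpty_or_nonempty {x | Minimal (· ∈ N.globalExponents) x} with he | he
  · refine ⟨N, .refl, fun J => ?_⟩
    have h := hN J
    rw [hm J, Set.range_eq_empty] at h
    simp [positiveHull] at h
  · have := Fintype.ofFinite {x | Minimal (· ∈ N.globalExponents) x}
    obtain ⟨N', m', hr, hc⟩ := PolyhedraSystem.exists_reaches_comparableOnStrata N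
      (Subtype.val : {x | Minimal (· ∈ N.globalExponents) x} → _) Finset.univ
    exact ⟨N', hr.reflTransGen, PolyhedraSystem.hasNormalCrossings_of_comparableOnStrata
      (hr.generatedBy hm) fun a b => hc (a, b) (Finset.mem_univ _)⟩
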